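/- Let $\nu\in\mathbb N$, let $a<b$ be real numbers, $\Omega=[a,b]^\nu$ with Lebesgue measure $\mu$, and let $k=k(x,s,y)$ be a continuous complex-valued function on $\Omega^3$. Let $T_1$ be the partial integral operator on the complex Hilbert space $L_2(\Omega\times\Omega)$ (a bounded linear operator) given by $$(T_1f)(x,y)=\int_\Omega k(x,s,y)f(s,y)\,ds .$$ For $y\in\Omega$ and $\varkappa\in\mathbb C$ let $$D_1(y;\varkappa)=1+\sum_{n=1}^\infty\frac{(-\varkappa)^n}{n!}\int_{\Omega^n}\det\bigl(k(x_i,x_j,y)\bigr)_{i,j=1}^n\,dx_1\cdots dx_n$$ be the Fredholm determinant of $E-\varkappa K_y$, where $E$ is the identity on $L_2(\Omega)$ and $K_y$ is the integral operator $(K_y\varphi)(x)=\int_\Omega k(x,s,y)\varphi(s)\,ds$ on $L_2(\Omega)$. A number $\varkappa\in\mathbb C$ is called a characteristic number of the equation $f-\varkappa T_1f=g_0$ if there is a measurable set $\Omega_0\subset\Omega$ with $\mu(\Omega_0)>0$ such that $D_1(y;\varkappa)=0$ for all $y\in\Omega_0$. Theorem. A number $\lambda\in\mathbb C$, $\lambda\neq0$,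 is an eigenvalue of $T_1$ if and only if $\lambda^{-1}$ is a characteristic number. -/

import Mathlib

open MeasureTheory

noncomputable section

/-- The cube `Ω = [a,b]^ν`, with the topology and the Lebesgue measure `μ` (`volume`) inherited
from `ℝ^ν`. -/
abbrev Cube (ν : ℕ) (a b : ℝ) : Type := ↥(Set.Icc (fun _ : Fin ν => a) (fun _ : Fin ν => b))

instance Cube.measureSpace (ν : ℕ) (a b : ℝ) : MeasureSpace (Cube ν a b) :=
  Measure.Subtype.measureSpace

instance Cube.isFiniteMeasure_volume (ν : ℕ) (a b : ℝ) :
    IsFiniteMeasure (volume : Measure (Cube ν a b)) := by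
  refine ⟨?_⟩
  rw [Measure.Subtype.volume_univ measurableSet_Icc.nullMeasurableSet]
  exact isCompact_Icc.measure_lt_top

/-- The Hilbert space `H = L₂(Ω × Ω)` of complex functions. -/
abbrev SqInt (ν : ℕ) (a b : ℝ) : Type :=
  Lp ℂ 2 (volume : Measure (Cube ν a b × Cube ν a b))

/-- A continuous kernel `k(x,s,y)` on `Ω³`, evaluated as `k (x, s, y)`. -/
abbrev Kern (ν : ℕ) (a b : ℝ) : Type := C(Cube ν a b × Cube ν a b × Cube ν a b, ℂ)

namespace PartialOp

variable {ν : ℕ} {a b : ℝ}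

/-- The function `(x,y) ↦ ∫_Ω k(x,s,y) f(s,y) ds`. -/
def partialIntegral (k : Kern ν a b) (f : Cube ν a b × Cube ν a b → ℂ) :
    Cube ν a b × Cube ν a b → ℂ :=
  fun p => ∫ s : Cube ν a b, k (p.1, s, p.2) * f (s, p.2)

theorem ae_section {P : Cube ν a b → Cube ν a b → Prop}
    (h : ∀ᵐ p : Cube ν a b × Cube ν a b, P p.1 p.2) :
    ∀ᵐ p : Cube ν a b × Cube ν a b, ∀ᵐ s : Cube ν a b, P s p.2 := by
  have h1 : ∀ᵐ q : Cube ν a b × Cube ν a b, P q.2 q.1 :=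
    (Measure.measurePreserving_swap (μ := (volume : Measure (Cube ν a b)))
      (ν := (volume : Measure (Cube ν a b)))).quasiMeasurePreserving.ae h
  have h2 : ∀ᵐ y : Cube ν a b, ∀ᵐ s : Cube ν a b, P s y := Measure.ae_ae_of_ae_prod h1
  exact (Measure.quasiMeasurePreserving_snd (μ := (volume : Measure (Cube ν a b)))
    (ν := (volume : Measure (Cube ν a b)))).ae h2

theorem aestronglyMeasurable_partialIntegral (k : Kern ν a b)
    {f : Cube ν a b × Cube ν a b → ℂ} (hf : AEStronglyMeasurable f) :
    AEStronglyMeasurable (partialIntegral k f) := by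
  have hg : StronglyMeasurable (hf.mk f) := hf.stronglyMeasurable_mk
  have hmeas : StronglyMeasurable (partialIntegral k (hf.mk f)) := by
    have : StronglyMeasurable (fun q : (Cube ν a b × Cube ν a b) × Cube ν a b =>
        k (q.1.1, q.2, q.1.2) * hf.mk f (q.2, q.1.2)) := by
      refine StronglyMeasurable.mul ?_ (hg.comp_measurable (by fun_prop))
      exact Continuous.stronglyMeasurable (by fun_prop)
    exact this.integral_prod_right'
  refine ⟨_, hmeas, ?_⟩
  have := ae_section (P := fun s y => f (s, y) = hf.mk f (s, y)) hf.ae_eq_mk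
  filter_upwards [this] with p hp
  refine integral_congr_ae ?_
  filter_upwards [hp] with s hs
  rw [hs]

theorem lintegral_partialIntegral_le (k : Kern ν a b)
    {f : Cube ν a b × Cube ν a b → ℂ} (hf : AEStronglyMeasurable f) :
    ∫⁻ p, ‖partialIntegral k f p‖ₑ ^ (2 : ℝ) ≤
      (‖k‖ₑ * volume (Set.univ : Set (Cube ν a b))) ^ (2 : ℝ) * ∫⁻ p, ‖f p‖ₑ ^ (2 : ℝ) := by
  set m := volume (Set.univ : Set (Cube ν a b)) with hm
  have hsec : ∀ᵐ y : Cube ν a b, AEStronglyMeasurable (fun s : Cube ν a b => f (s, y)) :=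
    AEStronglyMeasurable.prodMk_left
      (μ := (volume : Measure (Cube ν a b))) (ν := (volume : Measure (Cube ν a b)))
      (f := fun q => f (q.2, q.1)) hf.prod_swap
  have hsec' : ∀ᵐ p : Cube ν a b × Cube ν a b,
      AEStronglyMeasurable (fun s : Cube ν a b => f (s, p.2)) :=
    (Measure.quasiMeasurePreserving_snd (μ := (volume : Measure (Cube ν a b)))
      (ν := (volume : Measure (Cube ν a b)))).ae hsec
  have hpt : ∀ᵐ p : Cube ν a b × Cube ν a b, ‖partialIntegral k f p‖ₑ ^ (2 : ℝ) ≤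
      ‖k‖ₑ ^ (2 : ℝ) * (m * ∫⁻ s : Cube ν a b, ‖f (s, p.2)‖ₑ ^ (2 : ℝ)) := by
    filter_upwards [hsec'] with p hp
    have h1 : ‖partialIntegral k f p‖ₑ ≤ ‖k‖ₑ * ∫⁻ s : Cube ν a b, ‖f (s, p.2)‖ₑ := by
      refine (enorm_integral_le_lintegral_enorm _).trans ?_
      rw [← lintegral_const_mul'' _ hp.enorm]
      refine lintegral_mono fun s => ?_
      rw [enorm_mul]
      gcongr
      rw [enorm_le_iff_norm_le]
      exact k.norm_coe_le_norm _
    have h2 : (∫⁻ s : Cube ν a b, ‖f (s, p.2)‖ₑ) ^ (2 : ℝ) ≤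
        m * ∫⁻ s : Cube ν a b, ‖f (s, p.2)‖ₑ ^ (2 : ℝ) := by
      have := ENNReal.lintegral_mul_le_Lp_mul_Lq (volume : Measure (Cube ν a b))
        Real.HolderConjugate.two_two (f := fun _ => 1) (g := fun s => ‖f (s, p.2)‖ₑ)
        aemeasurable_const hp.enorm
      simp only [Pi.mul_apply, one_mul, ENNReal.one_rpow, lintegral_const, ← hm] at this
      refine (ENNReal.rpow_le_rpow this (by norm_num : (0 : ℝ) ≤ 2)).trans (le_of_eq ?_)
      rw [ENNReal.mul_rpow_of_nonneg _ _ (by norm_num), ← ENNReal.rpow_mul, ← ENNReal.rpow_mul]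
      norm_num
    calc ‖partialIntegral k f p‖ₑ ^ (2 : ℝ)
        ≤ (‖k‖ₑ * ∫⁻ s : Cube ν a b, ‖f (s, p.2)‖ₑ) ^ (2 : ℝ) := by gcongr
      _ = ‖k‖ₑ ^ (2 : ℝ) * (∫⁻ s : Cube ν a b, ‖f (s, p.2)‖ₑ) ^ (2 : ℝ) :=
          ENNReal.mul_rpow_of_nonneg _ _ (by norm_num)
      _ ≤ _ := by gcongr
  refine (lintegral_mono_ae hpt).trans (le_of_eq ?_)
  have hF : AEMeasurable (fun p : Cube ν a b × Cube ν a b => ‖f p‖ₑ ^ (2 : ℝ)) :=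
    hf.enorm.pow_const _
  have hF' : AEMeasurable (fun y : Cube ν a b => ∫⁻ s : Cube ν a b, ‖f (s, y)‖ₑ ^ (2 : ℝ)) := by
    exact AEMeasurable.lintegral_prod_left' hF
  have hF'' : AEMeasurable (fun p : Cube ν a b × Cube ν a b =>
      ∫⁻ s : Cube ν a b, ‖f (s, p.2)‖ₑ ^ (2 : ℝ)) :=
    hF'.comp_quasiMeasurePreserving Measure.quasiMeasurePreserving_snd
  have h3 : ∫⁻ p : Cube ν a b × Cube ν a b, ∫⁻ s : Cube ν a b, ‖f (s, p.2)‖ₑ ^ (2 : ℝ) =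
      m * ∫⁻ p, ‖f p‖ₑ ^ (2 : ℝ) := by
    rw [Measure.volume_eq_prod, lintegral_prod _ hF'', lintegral_prod_symm _ hF]
    simp only [lintegral_const, ← hm]
    rw [mul_comm]
  rw [lintegral_const_mul'' _ (hF''.const_mul m), lintegral_const_mul'' _ hF'', h3,
    ENNReal.mul_rpow_of_nonneg _ _ (by norm_num : (0 : ℝ) ≤ 2)]
  rw [show m ^ (2 : ℝ) = m * m by rw [ENNReal.rpow_two, sq]]
  ring

theorem eLpNorm_partialIntegral_le (k : Kern ν a b)
    {f : Cube ν a b × Cube ν a b → ℂ} (hf : AEStronglyMeasurable f) :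
    eLpNorm (partialIntegral k f) 2 volume ≤
      (‖k‖ₑ * volume (Set.univ : Set (Cube ν a b))) * eLpNorm f 2 volume := by
  rw [eLpNorm_eq_lintegral_rpow_enorm_toReal (by norm_num) (by norm_num),
    eLpNorm_eq_lintegral_rpow_enorm_toReal (by norm_num) (by norm_num)]
  simp only [ENNReal.toReal_ofNat]
  refine (ENNReal.rpow_le_rpow (lintegral_partialIntegral_le k hf) (by norm_num)).trans
    (le_of_eq ?_)
  rw [ENNReal.mul_rpow_of_nonneg _ _ (by norm_num), ← ENNReal.rpow_mul]
  norm_num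

theorem memLp_partialIntegral (k : Kern ν a b)
    {f : Cube ν a b × Cube ν a b → ℂ} (hf : MemLp f 2) : MemLp (partialIntegral k f) 2 :=
  ⟨aestronglyMeasurable_partialIntegral k hf.1,
    (eLpNorm_partialIntegral_le k hf.1).trans_lt
      (ENNReal.mul_lt_top (ENNReal.mul_lt_top enorm_lt_top (measure_lt_top _ _)) hf.2)⟩

theorem partialIntegral_congr (k : Kern ν a b) {f g : Cube ν a b × Cube ν a b → ℂ}
    (h : f =ᵐ[volume] g) : partialIntegral k f =ᵐ[volume] partialIntegral k g := by
  filter_upwards [ae_section (P := fun s y => f (s, y) = g (s, y)) h] with p hp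
  refine integral_congr_ae ?_
  filter_upwards [hp] with s hs
  rw [hs]

theorem ae_integrable_section (k : Kern ν a b) {f : Cube ν a b × Cube ν a b → ℂ}
    (hf : MemLp f 2) : ∀ᵐ p : Cube ν a b × Cube ν a b,
      Integrable (fun s : Cube ν a b => k (p.1, s, p.2) * f (s, p.2)) := by
  have hi : Integrable f ((volume : Measure (Cube ν a b)).prod volume) :=
    hf.integrable (by norm_num)
  have h2 : ∀ᵐ y : Cube ν a b, Integrable (fun s : Cube ν a b => f (s, y)) :=
    hi.swap.prod_right_ae
  filter_upwards [(Measure.quasiMeasurePreserving_snd (μ := (volume : Measure (Cube ν a b)))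
    (ν := (volume : Measure (Cube ν a b)))).ae h2] with p hp
  exact hp.bdd_mul (c := ‖k‖) (Continuous.aestronglyMeasurable (by fun_prop))
    (Filter.Eventually.of_forall fun s => k.norm_coe_le_norm _)

/-- The partial integral operator `(T₁ f)(x,y) = ∫_Ω k(x,s,y) f(s,y) ds`, as a bounded linear
operator on `L₂(Ω × Ω)`. -/
def T₁ (k : Kern ν a b) : SqInt ν a b →L[ℂ] SqInt ν a b :=
  LinearMap.mkContinuous
    { toFun := fun f => (memLp_partialIntegral k (Lp.memLp f)).toLp (partialIntegral k f)
      map_add' := fun f g => by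
        rw [← MemLp.toLp_add, MemLp.toLp_eq_toLp_iff]
        refine (partialIntegral_congr k (Lp.coeFn_add f g)).trans ?_
        filter_upwards [ae_integrable_section k (Lp.memLp f),
          ae_integrable_section k (Lp.memLp g)] with p hf hg
        simp only [partialIntegral, Pi.add_apply, mul_add]
        exact integral_add hf hg
      map_smul' := fun c f => by
        rw [RingHom.id_apply, ← MemLp.toLp_const_smul, MemLp.toLp_eq_toLp_iff]
        refine (partialIntegral_congr k (Lp.coeFn_smul c f)).trans ?_
        refine Filter.Eventually.of_forall fun p => ?_
        simp only [partialIntegral, Pi.smul_apply, smul_eq_mul, mul_left_comm _ c]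
        exact integral_const_mul c _ }
    (‖k‖ * volume.real (Set.univ : Set (Cube ν a b)))
    (fun f => by
      change ‖(memLp_partialIntegral k (Lp.memLp f)).toLp (partialIntegral k f)‖ ≤ _
      rw [Lp.norm_toLp, Lp.norm_def]
      refine (ENNReal.toReal_mono ?_ (eLpNorm_partialIntegral_le k (Lp.memLp f).1)).trans
        (le_of_eq ?_)
      · exact (ENNReal.mul_lt_top (ENNReal.mul_lt_top enorm_lt_top (measure_lt_top _ _))
          (Lp.memLp f).2).ne
      · rw [ENNReal.toReal_mul, ENNReal.toReal_mul, toReal_enorm]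
        rfl)

/-- The defining formula of `T₁`. -/
theorem T₁_ae_eq (k : Kern ν a b) (f : SqInt ν a b) :
    ∀ᵐ p : Cube ν a b × Cube ν a b,
      T₁ k f p = ∫ s : Cube ν a b, k (p.1, s, p.2) * f (s, p.2) :=
  MemLp.coeFn_toLp (memLp_partialIntegral k (Lp.memLp f))

/-- The determinant `D₁(y;ϰ)` of `E - ϰ T₁`: the Fredholm determinant
`∑ₙ (-ϰ)ⁿ/n! ∫_{Ωⁿ} det (k(xᵢ,xⱼ,y))_{i,j ≤ n} dx₁ ⋯ dxₙ` of `E - ϰ K_y`, where `K_y` is the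
integral operator on `L₂(Ω)` with the kernel `k(·,·,y)`. The term `n = 0` is `1`. -/
def D₁ (k : Kern ν a b) (y : Cube ν a b) (ϰ : ℂ) : ℂ :=
  ∑' n : ℕ, (-ϰ) ^ n / (n.factorial : ℂ) *
    ∫ x : Fin n → Cube ν a b, (Matrix.of fun i j : Fin n => k (x i, x j, y)).det

/-- The set of characteristic numbers of the equation `f - ϰ T₁ f = g₀`: the numbers `ϰ` such
that `D₁(y;ϰ) = 0` for all `y` in some measurable set of positive measure. -/
def characteristicNumbers (k : Kern ν a b) : Set ℂ :=
  {ϰ | ∃ Ω₀ : Set (Cube ν a b), MeasurableSet Ω₀ ∧ 0 < volume Ω₀ ∧ ∀ y ∈ Ω₀, D₁ k y ϰ = 0}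

end PartialOp

end

/-! `T₁` acts fibrewise: for almost every y the section f(·,y) of an eigenvector satisfies λφ = K_y
φ. Everything rests on Fredholm's series for the determinant D and the first minor M, which satisfy
M = D k + ϰ K_y M, its mirror image M = D k + ϰ M K_y, and D' = -∫ M(x,x) dx.

If D(y;1/λ) ≠ 0, the mirror relation makes K_y - λ injective (`ae_eq_zero_of_resolvent`). If this
holds for almost every y, then f = 0; so an eigenvector forces the zero set of D(·;1/λ) to have
positive measure.

Conversely, a zero of D gives an eigenfunction of K_y for each y in Ω₀, and these must be chosen
measurably in y. Fredholm's explicit solutions do this: the first Taylor coefficient of M in ϰ at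
1/λ that is not identically zero in (x,s) solves φ = λ⁻¹ K_y φ in x (`exists_minorTaylor_ne_zero`),
and all the coefficients are jointly continuous in (x,s,y). The order p and the point s depend on y,
but s may be taken in a countable dense set. One of the countably many pairs (p,s) therefore works
on a set of positive measure, and cutting off to that set gives an eigenvector of `T₁`. -/

noncomputable section

/-! ### Hadamard's inequality -/

open scoped ComplexOrder in
-- |det A|² is the product of the eigenvalues of A*A, and their sum is the trace, which is the sum
-- of the squared entries. The inequality of arithmetic and geometric means compares the two.
theorem Matrix.norm_det_sq_le {n : ℕ} (A : Matrix (Fin n) (Fin n) ℂ) {M : ℝ}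
    (hA : ∀ i j, ‖A i j‖ ≤ M) : ‖A.det‖ ^ 2 ≤ (n * M ^ 2) ^ n := by
  rcases Nat.eq_zero_or_pos n with rfl | hn
  · simp
  have hn' : (0 : ℝ) < n := by exact_mod_cast hn
  have hP : (A.conjTranspose * A).PosSemidef := Matrix.posSemidef_conjTranspose_mul_self A
  set e := hP.isHermitian.eigenvalues with he
  have he0 : ∀ i, 0 ≤ e i := hP.eigenvalues_nonneg
  have hdet : ‖A.det‖ ^ 2 = ∏ i, e i := by
    have h := hP.isHermitian.det_eq_prod_eigenvalues
    rw [Matrix.det_mul, Matrix.det_conjTranspose] at h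
    have h2 : ((‖A.det‖ ^ 2 : ℝ) : ℂ) = ((∏ i, e i : ℝ) : ℂ) := by
      rw [Complex.ofReal_prod]
      refine Eq.trans ?_ h
      rw [Complex.star_def, Complex.conj_mul']
      push_cast; rfl
    exact_mod_cast h2
  have htr : ∑ i, e i ≤ n * (n * M ^ 2) := by
    have h := hP.isHermitian.trace_eq_sum_eigenvalues
    have h2 : ((∑ i, e i : ℝ) : ℂ) = ((∑ i, ∑ j, ‖A j i‖ ^ 2 : ℝ) : ℂ) := by
      rw [Complex.ofReal_sum]
      refine h.symm.trans ?_
      simp [Matrix.trace, Matrix.mul_apply, Complex.conj_mul']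
    have h3 : ∑ i, e i = ∑ i, ∑ j, ‖A j i‖ ^ 2 := by exact_mod_cast h2
    rw [h3]
    calc ∑ i, ∑ j, ‖A j i‖ ^ 2 ≤ ∑ i : Fin n, ∑ j : Fin n, M ^ 2 := by
          gcongr with i _ j _; exact hA j i
      _ = _ := by simp
  have h := Real.geom_mean_le_arith_mean_weighted Finset.univ (fun _ : Fin n => (1 / n : ℝ)) e
    (fun _ _ => by positivity) (by simp [hn'.ne']) (fun i _ => he0 i)
  rw [hdet]
  have h4 : ∑ i, (1 / n : ℝ) * e i ≤ n * M ^ 2 := by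
    rw [← Finset.mul_sum]
    calc (1 / n : ℝ) * ∑ i, e i ≤ 1 / n * (n * (n * M ^ 2)) := by gcongr
      _ = n * M ^ 2 := by field_simp
  have h5 : ∏ i, e i = (∏ i, e i ^ (1 / n : ℝ)) ^ n := by
    rw [← Finset.prod_pow]
    refine Finset.prod_congr rfl fun i _ => ?_
    rw [← Real.rpow_natCast, ← Real.rpow_mul (he0 i)]
    field_simp
    simp
  rw [h5]
  exact pow_le_pow_left₀ (Finset.prod_nonneg fun i _ => Real.rpow_nonneg (he0 i) _) (h.trans h4) n

theorem Matrix.norm_det_le_sqrt_pow {n : ℕ} (A : Matrix (Fin n) (Fin n) ℂ) {M : ℝ} (hM : 0 ≤ M)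
    (hA : ∀ i j, ‖A i j‖ ≤ M) : ‖A.det‖ ≤ (√n * M) ^ n := by
  refine le_of_sq_le_sq ?_ (by positivity)
  refine (A.norm_det_sq_le hA).trans (le_of_eq ?_)
  rw [← pow_mul, mul_comm n 2, pow_mul, mul_pow (√n : ℝ) M 2, Real.sq_sqrt (by positivity)]

/-! ### Entire functions through their coefficients -/

/-- The sequences of Taylor coefficients of entire functions. -/
def IsEntireSeq (b : ℕ → ℂ) : Prop := ∀ r : ℝ, 0 ≤ r → Summable fun n => ‖b n‖ * r ^ n

/-- The `p`-th Taylor coefficient at `z` of the entire function `∑ b n * z ^ n`. -/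
def taylorCoeff (b : ℕ → ℂ) (z : ℂ) (p : ℕ) : ℂ := ∑' n, (n.choose p * z ^ (n - p)) * b n

theorem norm_choose_mul_pow_le (z : ℂ) (n p : ℕ) :
    ‖(n.choose p * z ^ (n - p) : ℂ)‖ ≤ (1 + ‖z‖) ^ n := by
  rw [norm_mul, norm_pow, Complex.norm_natCast]
  rcases lt_or_ge n p with h | h
  · rw [Nat.choose_eq_zero_of_lt h]; simp; positivity
  · rw [add_pow]
    have := Finset.single_le_sum (f := fun m => (1 : ℝ) ^ m * ‖z‖ ^ (n - m) * (n.choose m : ℝ))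
      (fun i _ => by positivity) (Finset.mem_range.2 (Nat.lt_succ_of_le h))
    simpa [mul_comm] using this

theorem IsEntireSeq.summable_norm {b : ℕ → ℂ} (hb : IsEntireSeq b) (z : ℂ) (p : ℕ) :
    Summable fun n => ‖(n.choose p * z ^ (n - p)) * b n‖ := by
  refine Summable.of_nonneg_of_le (fun _ => norm_nonneg _) (fun n => ?_)
    (hb (1 + ‖z‖) (by positivity))
  rw [norm_mul, mul_comm]
  gcongr
  exact norm_choose_mul_pow_le z n p

theorem IsEntireSeq.of_le {b : ℕ → ℂ} {c : ℕ → ℝ} (hc : ∀ r : ℝ, 0 ≤ r → Summable fun n => c n * r ^ n)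
    (h : ∀ n, ‖b n‖ ≤ c n) : IsEntireSeq b := fun r hr =>
  Summable.of_nonneg_of_le (fun _ => by positivity) (fun n => by gcongr; exact h n) (hc r hr)

/-- The expansion about z, evaluated at 0. The rearrangement is absolutely convergent with majorant
`‖b n‖ * (2‖z‖) ^ n`, and the binomial theorem leaves (-z + z)ⁿ, which kills every term but the
first. -/
theorem tsum_neg_pow_mul_taylorCoeff {b : ℕ → ℂ} (hb : IsEntireSeq b) (z : ℂ) :
    ∑' p, (-z) ^ p * taylorCoeff b z p = b 0 := by
  have hsum : Summable (Function.uncurry fun (n p : ℕ) =>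
      (-z) ^ p * ((n.choose p * z ^ (n - p)) * b n)) := by
    rw [← summable_norm_iff, summable_prod_of_nonneg (fun _ => norm_nonneg _)]
    have hfin : ∀ n, HasSum (fun p => ‖(-z) ^ p * ((n.choose p * z ^ (n - p)) * b n)‖)
        (‖b n‖ * (‖z‖ + ‖z‖) ^ n) := by
      intro n
      have : ‖b n‖ * (‖z‖ + ‖z‖) ^ n =
          ∑ p ∈ Finset.range (n + 1), ‖(-z) ^ p * ((n.choose p * z ^ (n - p)) * b n)‖ := by
        rw [add_pow, Finset.mul_sum]
        refine Finset.sum_congr rfl fun p _ => ?_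
        simp; ring
      rw [this]
      refine hasSum_sum_of_ne_finset_zero fun p hp => ?_
      rw [Nat.choose_eq_zero_of_lt (by simpa using hp)]; simp
    refine ⟨fun n => (hfin n).summable, ?_⟩
    simp only [Function.uncurry]
    simp_rw [(hfin _).tsum_eq]
    exact hb _ (by positivity)
  simp only [taylorCoeff, ← tsum_mul_left]
  rw [hsum.tsum_comm]
  have hfin : ∀ n, ∑' p, (-z) ^ p * ((n.choose p * z ^ (n - p)) * b n) = (-z + z) ^ n * b n := by
    intro n
    rw [tsum_eq_sum (s := Finset.range (n + 1)), add_pow, Finset.sum_mul]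
    · refine Finset.sum_congr rfl fun p _ => by ring
    · intro p hp
      rw [Nat.choose_eq_zero_of_lt (by simpa using hp)]; simp
  simp_rw [hfin]
  rw [tsum_eq_single 0]
  · simp
  · intro n hn; simp [hn]

theorem exists_taylorCoeff_ne_zero {b : ℕ → ℂ} (hb : IsEntireSeq b) (h0 : b 0 ≠ 0) (z : ℂ) :
    ∃ p, taylorCoeff b z p ≠ 0 := by
  by_contra! h
  exact h0 (by simpa [h] using (tsum_neg_pow_mul_taylorCoeff hb z).symm)

/-! ### Convergence of the Fredholm series -/

/-- The bound on the terms of the Fredholm series given by Hadamard's inequality. -/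
def fredholmBound (M c : ℝ) (n : ℕ) : ℝ := (√(n + 1 : ℕ) * M) ^ (n + 1) * c ^ n / n.factorial

/-- Hadamard's factor grows like n^(n/2), so the square of a term is of the size Bⁿ/n!. Squares are
traded for the terms themselves by t ≤ 4ⁿt² + 4⁻ⁿ. -/
theorem summable_fredholmBound {M c : ℝ} (hM : 0 ≤ M) (hc : 0 ≤ c) (r : ℝ) (hr : 0 ≤ r) :
    Summable fun n => fredholmBound M c n * r ^ n := by
  -- In the 8e, the e comes from mᵐ ≤ eᵐ m!, a factor 2 from n + 1 ≤ 2ⁿ, and a factor 4 from the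
  -- weight 4ⁿ.
  set A := 8 * Real.exp 1 * (M * c * r) ^ 2 with hA
  have h1 : Summable fun n : ℕ => Real.exp 1 * M ^ 2 * (A ^ n / n.factorial) + (1 / 4 : ℝ) ^ n :=
    ((Real.summable_pow_div_factorial A).mul_left _).add
      (summable_geometric_of_lt_one (by norm_num) (by norm_num))
  refine Summable.of_nonneg_of_le (fun n => ?_) (fun n => ?_) h1
  · unfold fredholmBound; positivity
  set t := fredholmBound M c n * r ^ n with ht
  have hfac : (0 : ℝ) < n.factorial := by exact_mod_cast n.factorial_pos
  have h2 : ((n + 1 : ℕ) : ℝ) ^ (n + 1) ≤ Real.exp 1 ^ (n + 1) * (2 ^ n * n.factorial) := by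
    have h := Real.pow_div_factorial_le_exp ((n + 1 : ℕ) : ℝ) (by positivity) (n + 1)
    rw [div_le_iff₀ (by positivity)] at h
    refine h.trans ?_
    rw [← Real.exp_one_pow]
    gcongr
    rw [Nat.factorial_succ]
    have : n + 1 ≤ 2 ^ n := Nat.lt_two_pow_self
    push_cast
    gcongr
    exact_mod_cast this
  have h3 : 4 ^ n * t ^ 2 ≤ Real.exp 1 * M ^ 2 * (A ^ n / n.factorial) := by
    have e1 : 4 ^ n * t ^ 2 = ((n + 1 : ℕ) : ℝ) ^ (n + 1) *
        (4 ^ n * M ^ 2 * ((M * c * r) ^ 2) ^ n / (n.factorial : ℝ) ^ 2) := by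
      have : (√((n + 1 : ℕ) : ℝ) ^ (n + 1)) ^ 2 = ((n + 1 : ℕ) : ℝ) ^ (n + 1) := by
        rw [← pow_mul, mul_comm, pow_mul, Real.sq_sqrt (by positivity)]
      rw [ht, ← this, fredholmBound]
      simp only [mul_pow, div_pow, ← pow_mul]
      ring
    rw [e1]
    calc _ ≤ (Real.exp 1 ^ (n + 1) * (2 ^ n * n.factorial)) *
        (4 ^ n * M ^ 2 * ((M * c * r) ^ 2) ^ n / (n.factorial : ℝ) ^ 2) := by gcongr
      _ = _ := by
        rw [hA, show (8 : ℝ) = 2 * 4 by norm_num]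
        simp only [mul_pow]
        field_simp
        ring
  have h4 : (4 : ℝ) ^ n * (1 / 4) ^ n = 1 := by rw [← mul_pow]; norm_num
  have h5 : (0 : ℝ) < (1 / 4) ^ n := by positivity
  -- Expanding (2ⁿt - 2⁻ⁿ)² ≥ 0 gives 2t ≤ 4ⁿt² + 4⁻ⁿ.
  nlinarith [sq_nonneg (2 ^ n * t - (1 / 2) ^ n), h3, h4, h5,
    show (2 : ℝ) ^ n * (1 / 2) ^ n = 1 by rw [← mul_pow]; norm_num,
    show ((2 : ℝ) ^ n) ^ 2 = 4 ^ n by rw [← pow_mul, mul_comm, pow_mul]; norm_num,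
    show ((1 / 2 : ℝ) ^ n) ^ 2 = (1 / 4) ^ n by rw [← pow_mul, mul_comm, pow_mul]; norm_num,
    sq_nonneg t, show 0 ≤ t by rw [ht]; unfold fredholmBound; positivity]

/-! ### Fredholm determinant and first minor: recursions and bounds -/

section Fredholm

set_option linter.unusedSectionVars false

variable {X Y : Type*} [TopologicalSpace X] [CompactSpace X] [T2Space X]
  [SecondCountableTopology X] [MeasureSpace X] [BorelSpace X]
  [IsFiniteMeasure (volume : Measure X)]
  [TopologicalSpace Y] [CompactSpace Y] [T2Space Y] [SecondCountableTopology Y]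

theorem Continuous.integrable_of_compactSpace {Z : Type*} [TopologicalSpace Z] [CompactSpace Z]
    [MeasurableSpace Z] [OpensMeasurableSpace Z] {μ : Measure Z}
    [IsFiniteMeasure μ] {f : Z → ℂ} (hf : Continuous f) : Integrable f μ :=
  hf.integrable_of_hasCompactSupport (HasCompactSupport.of_compactSpace f)

theorem continuous_integral_of_compactSpace {Z : Type*} [TopologicalSpace Z] [CompactSpace Z]
    [MeasurableSpace Z] [OpensMeasurableSpace Z] {μ : Measure Z}
    [IsFiniteMeasure μ] {W : Type*} [TopologicalSpace W] [FirstCountableTopology W]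
    [LocallyCompactSpace W] {f : W → Z → ℂ} (hf : Continuous f.uncurry) :
    Continuous fun w => ∫ z, f w z ∂μ := by
  simpa using continuous_parametric_integral_of_continuous (μ := μ) hf isCompact_univ

variable (k : C(X × X × Y, ℂ))

/-- The coefficient of `ϰⁿ` in the Fredholm determinant of `1 - ϰ K_y`. -/
def fredholmCoeff (n : ℕ) (y : Y) : ℂ :=
  (-1) ^ n / (n.factorial : ℂ) *
    ∫ x : Fin n → X, (Matrix.of fun i j : Fin n => k (x i, x j, y)).det

/-- The determinant of the kernel at the points `x, z₁, …, zₙ` and `s, z₁, …, zₙ`. -/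
def borderedDet (n : ℕ) (x s : X) (y : Y) (z : Fin n → X) : ℂ :=
  (Matrix.of fun i j : Fin (n + 1) =>
    k ((Fin.cons x z : Fin (n + 1) → X) i, (Fin.cons s z : Fin (n + 1) → X) j, y)).det

/-- The coefficient of `ϰⁿ` in the first Fredholm minor of `1 - ϰ K_y`. -/
def fredholmMinor (n : ℕ) (x s : X) (y : Y) : ℂ :=
  (-1) ^ n / (n.factorial : ℂ) * ∫ z : Fin n → X, borderedDet k n x s y z

theorem continuous_borderedDet (n : ℕ) :
    Continuous fun q : (X × X × Y) × (Fin n → X) => borderedDet k n q.1.1 q.1.2.1 q.1.2.2 q.2 := by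
  unfold borderedDet
  refine Continuous.matrix_det (continuous_matrix fun i j => k.continuous.comp ?_)
  have h1 : Continuous fun q : (X × X × Y) × (Fin n → X) =>
      (Fin.cons q.1.1 q.2 : Fin (n + 1) → X) i := by
    refine Fin.cases ?_ (fun i => ?_) i <;> simp <;> fun_prop
  have h2 : Continuous fun q : (X × X × Y) × (Fin n → X) =>
      (Fin.cons q.1.2.1 q.2 : Fin (n + 1) → X) j := by
    refine Fin.cases ?_ (fun i => ?_) j <;> simp <;> fun_prop
  exact h1.prodMk (h2.prodMk (by fun_prop))

theorem continuous_fredholmMinor (n : ℕ) :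
    Continuous fun q : X × X × Y => fredholmMinor k n q.1 q.2.1 q.2.2 :=
  continuous_const.mul (continuous_integral_of_compactSpace (continuous_borderedDet k n))

theorem continuous_fredholmCoeff (n : ℕ) : Continuous (fredholmCoeff k n) := by
  refine continuous_const.mul (continuous_integral_of_compactSpace ?_)
  exact Continuous.matrix_det (continuous_matrix fun i j => k.continuous.comp (by fun_prop))

/-- Laplace expansion along the row of x. In the cofactor of the column of `w i`, moving the row of
`w i` to the top is a cycle of sign (-1)^i, which turns the cofactor sign (-1)^(i+1) into -1. -/
theorem det_bordered_expansion (n : ℕ) (x s : X) (y : Y) (w : Fin (n + 1) → X) :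
    borderedDet k (n + 1) x s y w =
      k (x, s, y) * (Matrix.of fun i j : Fin (n + 1) => k (w i, w j, y)).det -
      ∑ i : Fin (n + 1), k (x, w i, y) * borderedDet k n (w i) s y (i.removeNth w) := by
  rw [borderedDet, Matrix.det_succ_row_zero, Fin.sum_univ_succ, sub_eq_add_neg,
    ← Finset.sum_neg_distrib]
  congr 1
  · simp only [Fin.val_zero, pow_zero, one_mul, Matrix.of_apply, Fin.cons_zero]
    congr 2
  · refine Finset.sum_congr rfl fun i _ => ?_
    have h : ((Matrix.of fun i j : Fin (n + 2) => k ((Fin.cons x w : Fin (n + 2) → X) i,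
        (Fin.cons s w : Fin (n + 2) → X) j, y)).submatrix Fin.succ i.succ.succAbove) =
        (Matrix.of fun a b : Fin (n + 1) => k ((Fin.cons (w i) (i.removeNth w) : Fin (n + 1) → X) a,
          (Fin.cons s (i.removeNth w) : Fin (n + 1) → X) b, y)).submatrix i.cycleRange id := by
      ext a b
      simp only [Matrix.submatrix_apply, Matrix.of_apply, id, Fin.cons_succ,
        Fin.cons_removeNth_eq_comp_cycleRange_symm, Function.comp, Equiv.symm_apply_apply]
      congr 3
      refine Fin.cases ?_ (fun b => ?_) b
      · simp
      · simp [Fin.removeNth]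
    rw [h, Matrix.det_permute, Fin.sign_cycleRange, borderedDet]
    have h1 : ((-1 : ℂ) ^ (i : ℕ)) * (-1) ^ (i : ℕ) = 1 := by rw [← mul_pow]; simp
    simp only [Matrix.of_apply, Fin.cons_zero, Fin.cons_succ, Fin.val_succ, pow_succ]
    push_cast
    linear_combination (-(k (x, w i, y) * (Matrix.of fun a b : Fin (n + 1) =>
        k ((Fin.cons (w i) (i.removeNth w) : Fin (n + 1) → X) a,
          (Fin.cons s (i.removeNth w) : Fin (n + 1) → X) b, y)).det)) * h1

theorem fredholmMinor_zero (x s : X) (y : Y) :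
    fredholmMinor k 0 x s y = fredholmCoeff k 0 y * k (x, s, y) := by
  simp [fredholmMinor, fredholmCoeff, borderedDet, volume_pi]

theorem fredholmCoeff_zero (y : Y) : fredholmCoeff k 0 y = 1 := by
  simp [fredholmCoeff, volume_pi, Measure.real]

theorem integral_comp_removeNth {n : ℕ} (i : Fin (n + 1)) (H : X → (Fin n → X) → ℂ)
    (hH : Continuous H.uncurry) :
    ∫ w : Fin (n + 1) → X, H (w i) (i.removeNth w) = ∫ t, ∫ z, H t z := by
  have h := (volume_preserving_piFinSuccAbove (fun _ : Fin (n + 1) => X) i).integral_comp'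
    H.uncurry
  rw [Measure.volume_eq_prod, integral_prod _ hH.integrable_of_compactSpace] at h
  exact h

/-- The coefficient form of M = D k + ϰ K_y M. The n + 1 terms of the expanded sum have equal
integrals, and the factor n + 1 reduces 1/(n+1)! to 1/n!. -/
theorem fredholmMinor_succ (n : ℕ) (x s : X) (y : Y) :
    fredholmMinor k (n + 1) x s y =
      fredholmCoeff k (n + 1) y * k (x, s, y) + ∫ t, k (x, t, y) * fredholmMinor k n t s y := by
  have hc : Continuous fun q : X × (Fin n → X) => k (x, q.1, y) * borderedDet k n q.1 s y q.2 :=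
    (by fun_prop : Continuous fun q : X × (Fin n → X) => k (x, q.1, y)).mul
      ((continuous_borderedDet k n).comp
        (by fun_prop : Continuous fun q : X × (Fin n → X) => ((q.1, s, y), q.2)))
  have hi : ∀ i : Fin (n + 1), ∫ w : Fin (n + 1) → X, k (x, w i, y) *
      borderedDet k n (w i) s y (i.removeNth w) = ∫ t, ∫ z, k (x, t, y) * borderedDet k n t s y z :=
    fun i => integral_comp_removeNth i (fun t z => k (x, t, y) * borderedDet k n t s y z) hc
  have hint : ∀ i ∈ Finset.univ, Integrable fun w : Fin (n + 1) → X => k (x, w i, y) *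
      borderedDet k n (w i) s y (i.removeNth w) := fun i _ => by
    refine Continuous.integrable_of_compactSpace (hc.comp
      (?_ : Continuous fun w : Fin (n + 1) → X => (w i, i.removeNth w)))
    unfold Fin.removeNth
    fun_prop
  have hdet : Integrable fun w : Fin (n + 1) → X =>
      k (x, s, y) * (Matrix.of fun i j : Fin (n + 1) => k (w i, w j, y)).det := by
    refine Continuous.integrable_of_compactSpace (continuous_const.mul (Continuous.matrix_det
      (continuous_matrix fun i j => k.continuous.comp (by fun_prop))))
  rw [fredholmMinor]
  simp_rw [det_bordered_expansion]
  rw [integral_sub hdet (integrable_finsetSum _ hint), integral_finsetSum _ hint]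
  simp_rw [hi]
  simp only [integral_const_mul, fredholmMinor, fredholmCoeff, Finset.sum_const, Finset.card_univ,
    Fintype.card_fin, mul_left_comm (k _)]
  have : (n.factorial : ℂ) ≠ 0 := by exact_mod_cast n.factorial_ne_zero
  have : (n + 1 : ℂ) ≠ 0 := by exact_mod_cast n.succ_ne_zero
  rw [Nat.factorial_succ]
  push_cast
  simp only [nsmul_eq_mul]
  push_cast
  field_simp
  ring

/-- The coefficient form of D' = -∫ M(x,x) dx: on the diagonal the bordered determinant is the
determinant at n + 1 points. -/
theorem succ_mul_fredholmCoeff_succ (n : ℕ) (y : Y) :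
    (n + 1 : ℂ) * fredholmCoeff k (n + 1) y = -∫ x, fredholmMinor k n x x y := by
  have hc : Continuous fun q : X × (Fin n → X) => borderedDet k n q.1 q.1 y q.2 :=
    (continuous_borderedDet k n).comp
        (by fun_prop : Continuous fun q : X × (Fin n → X) => ((q.1, q.1, y), q.2))
  have h := integral_comp_removeNth 0 (fun t z => borderedDet k n t t y z) hc
  have h2 : ∀ w : Fin (n + 1) → X, borderedDet k n (w 0) (w 0) y (Fin.removeNth 0 w) =
      (Matrix.of fun i j : Fin (n + 1) => k (w i, w j, y)).det := by
    intro w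
    have : (Fin.cons (w 0) (Fin.removeNth 0 w) : Fin (n + 1) → X) = w := by
      simp
    rw [borderedDet, this]
  simp_rw [h2] at h
  simp only [fredholmMinor, fredholmCoeff, integral_const_mul]
  rw [h]
  have : (n.factorial : ℂ) ≠ 0 := by exact_mod_cast n.factorial_ne_zero
  have : (n + 1 : ℂ) ≠ 0 := by exact_mod_cast n.succ_ne_zero
  rw [Nat.factorial_succ]
  push_cast
  field_simp
  ring

theorem norm_fredholmMinor_le (n : ℕ) (x s : X) (y : Y) :
    ‖fredholmMinor k n x s y‖ ≤ fredholmBound ‖k‖ (volume.real (Set.univ : Set X)) n := by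
  have h : ‖∫ z : Fin n → X, borderedDet k n x s y z‖ ≤
      (√(n + 1 : ℕ) * ‖k‖) ^ (n + 1) * volume.real (Set.univ : Set (Fin n → X)) :=
    norm_integral_le_of_norm_le_const (Filter.Eventually.of_forall fun z =>
      Matrix.norm_det_le_sqrt_pow _ (norm_nonneg k) fun i j => k.norm_coe_le_norm _)
  have hv : volume.real (Set.univ : Set (Fin n → X)) = volume.real (Set.univ : Set X) ^ n := by
    simp [Measure.real, volume_pi, Measure.pi_univ]
  rw [hv] at h
  rw [fredholmMinor, fredholmBound, norm_mul, norm_div, norm_pow, norm_neg, norm_one, one_pow,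
    Complex.norm_natCast, div_mul_eq_mul_div, one_mul]
  gcongr

theorem isEntireSeq_fredholmMinor (x s : X) (y : Y) :
    IsEntireSeq fun n => fredholmMinor k n x s y :=
  .of_le (summable_fredholmBound (norm_nonneg _) measureReal_nonneg)
    fun n => norm_fredholmMinor_le k n x s y

/-- The trace identity transfers the bound on the minor to the determinant; the factor n + 1 ≥ 1 is
discarded. -/
theorem norm_fredholmCoeff_succ_le (n : ℕ) (y : Y) :
    ‖fredholmCoeff k (n + 1) y‖ ≤ fredholmBound ‖k‖ (volume.real (Set.univ : Set X)) n *
      volume.real (Set.univ : Set X) := by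
  have h := norm_integral_le_of_norm_le_const (μ := (volume : Measure X))
    (Filter.Eventually.of_forall fun x => norm_fredholmMinor_le k n x x y)
  rw [← norm_neg, ← succ_mul_fredholmCoeff_succ, norm_mul] at h
  refine le_trans ?_ h
  refine le_mul_of_one_le_left (norm_nonneg _) ?_
  rw [← Nat.cast_succ, Complex.norm_natCast]
  simp

/-- A bound on the coefficients of the Fredholm determinant, uniform in the parameter. -/
def fredholmCoeffBound (n : ℕ) : ℝ :=
  n.casesOn 1 fun n => fredholmBound ‖k‖ (volume.real (Set.univ : Set X)) n *
      volume.real (Set.univ : Set X)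

theorem norm_fredholmCoeff_le (n : ℕ) (y : Y) : ‖fredholmCoeff k n y‖ ≤ fredholmCoeffBound k n := by
  cases n with
  | zero => simp [fredholmCoeff_zero, fredholmCoeffBound]
  | succ n => exact norm_fredholmCoeff_succ_le k n y

theorem summable_fredholmCoeffBound (r : ℝ) (hr : 0 ≤ r) :
    Summable fun n => fredholmCoeffBound k n * r ^ n := by
  rw [← summable_nat_add_iff 1]
  refine ((summable_fredholmBound (norm_nonneg k)
    (measureReal_nonneg (μ := (volume : Measure X)) (s := Set.univ)) r hr).mul_left
    (volume.real (Set.univ : Set X) * r)).congr fun n => ?_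
  simp only [fredholmCoeffBound]
  ring

theorem isEntireSeq_fredholmCoeff (y : Y) : IsEntireSeq fun n => fredholmCoeff k n y :=
  .of_le (summable_fredholmCoeffBound k) fun n => norm_fredholmCoeff_le k n y

/-! ### Taylor coefficients of the determinant and the minor, continuous in the parameter -/

theorem continuous_taylorCoeff {W : Type*} [TopologicalSpace W] {b : ℕ → W → ℂ} {c : ℕ → ℝ}
    (hb : ∀ n, Continuous (b n)) (hc : ∀ r : ℝ, 0 ≤ r → Summable fun n => c n * r ^ n)
    (h : ∀ n w, ‖b n w‖ ≤ c n) (z : ℂ) (p : ℕ) :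
    Continuous fun w => taylorCoeff (fun n => b n w) z p := by
  refine continuous_tsum (fun n => continuous_const.mul (hb n)) (hc (1 + ‖z‖) (by positivity))
    fun n w => ?_
  rw [norm_mul, mul_comm]
  have := (norm_nonneg _).trans (h n w)
  gcongr
  · exact h n w
  · exact norm_choose_mul_pow_le z n p

/-- The `p`-th Taylor coefficient at `z` of the Fredholm determinant. -/
def detTaylor (z : ℂ) (p : ℕ) (y : Y) : ℂ := taylorCoeff (fun n => fredholmCoeff k n y) z p

/-- The `p`-th Taylor coefficient at `z` of the first Fredholm minor. -/
def minorTaylor (z : ℂ) (p : ℕ) (x s : X) (y : Y) : ℂ :=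
  taylorCoeff (fun n => fredholmMinor k n x s y) z p

theorem continuous_detTaylor (z : ℂ) (p : ℕ) : Continuous (detTaylor k z p) :=
  continuous_taylorCoeff (continuous_fredholmCoeff k) (summable_fredholmCoeffBound k)
    (norm_fredholmCoeff_le k) z p

theorem continuous_minorTaylor (z : ℂ) (p : ℕ) :
    Continuous fun q : X × X × Y => minorTaylor k z p q.1 q.2.1 q.2.2 :=
  continuous_taylorCoeff (continuous_fredholmMinor k)
    (summable_fredholmBound (norm_nonneg k) (measureReal_nonneg (μ := volume) (s := Set.univ)))
    (fun n q => norm_fredholmMinor_le k n q.1 q.2.1 q.2.2) z p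

theorem continuous_minorTaylor_comp {z : ℂ} {p : ℕ} {W : Type*} [TopologicalSpace W] {f g : W → X}
    {h : W → Y} (hf : Continuous f) (hg : Continuous g) (hh : Continuous h) :
    Continuous fun w => minorTaylor k z p (f w) (g w) (h w) := by
  have h1 := (continuous_minorTaylor k z p).comp (hf.prodMk (hg.prodMk hh))
  exact h1

/-! ### Fredholm's relations expanded about an arbitrary point -/

theorem choose_succ_mul_pow (z : ℂ) (n p : ℕ) :
    ((n + 1).choose (p + 1) * z ^ (n + 1 - (p + 1)) : ℂ) =
      z * (n.choose (p + 1) * z ^ (n - (p + 1))) + n.choose p * z ^ (n - p) := by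
  rw [Nat.choose_succ_succ, Nat.add_sub_add_right]
  push_cast
  rcases Nat.lt_or_ge p n with h | h
  · have : n - p = n - (p + 1) + 1 := by omega
    rw [this, pow_succ]; ring
  · rw [Nat.choose_eq_zero_of_lt (show n < p + 1 by omega)]; simp

theorem IsEntireSeq.summable {b : ℕ → ℂ} (hb : IsEntireSeq b) (z : ℂ) (p : ℕ) :
    Summable fun n => (n.choose p * z ^ (n - p)) * b n := (hb.summable_norm z p).of_norm

/-- The contribution of the shifted sequence `b (n - 1)` to the `p`-th Taylor coefficient. -/
def shiftTaylor (b : ℕ → ℂ) (z : ℂ) (p : ℕ) : ℂ :=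
  z * taylorCoeff b z p + p.casesOn 0 fun q => taylorCoeff b z q

theorem shiftTaylor_zero (b : ℕ → ℂ) (z : ℂ) : shiftTaylor b z 0 = z * taylorCoeff b z 0 :=
  add_zero _

theorem shiftTaylor_succ (b : ℕ → ℂ) (z : ℂ) (p : ℕ) :
    shiftTaylor b z (p + 1) = z * taylorCoeff b z (p + 1) + taylorCoeff b z p := rfl

/-- The shifted sequence belongs to ζB(ζ) = zB(ζ) + (ζ - z)B(ζ), whose p-th coefficient at z
involves only those of B of orders p and p - 1. -/
theorem tsum_choose_succ {b : ℕ → ℂ} (hb : IsEntireSeq b) (z : ℂ) (p : ℕ) :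
    ∑' n, (((n + 1).choose p * z ^ (n + 1 - p) : ℂ)) * b n = shiftTaylor b z p := by
  cases p with
  | zero =>
    rw [shiftTaylor_zero, taylorCoeff, ← tsum_mul_left]
    refine tsum_congr fun n => ?_
    simp [pow_succ]; ring
  | succ p =>
    rw [shiftTaylor_succ, taylorCoeff, taylorCoeff, ← tsum_mul_left,
      ← ((hb.summable z (p + 1)).mul_left z).tsum_add (hb.summable z p)]
    refine tsum_congr fun n => ?_
    rw [choose_succ_mul_pow]; ring

theorem summable_choose_succ_bound {c : ℕ → ℝ} (hc0 : ∀ n, 0 ≤ c n)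
    (hc : ∀ r : ℝ, 0 ≤ r → Summable fun n => c n * r ^ n) (z : ℂ) (p : ℕ) :
    Summable fun n => ‖((n + 1).choose p * z ^ (n + 1 - p) : ℂ)‖ * c n := by
  refine Summable.of_nonneg_of_le (fun n => mul_nonneg (norm_nonneg _) (hc0 n)) (fun n => ?_)
    ((hc (1 + ‖z‖) (by positivity)).mul_left (1 + ‖z‖))
  calc _ ≤ (1 + ‖z‖) ^ (n + 1) * c n := by
        gcongr
        · exact hc0 n
        · exact norm_choose_mul_pow_le z (n + 1) p
    _ = _ := by ring

theorem integral_tsum_mul {Z : Type*} [TopologicalSpace Z] [CompactSpace Z] [MeasurableSpace Z]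
    [OpensMeasurableSpace Z] {μ : Measure Z} [IsFiniteMeasure μ] (a : ℕ → ℂ) (b : ℕ → Z → ℂ)
    (c : ℕ → ℝ) (hb : ∀ n, Continuous (b n)) (h : ∀ n w, ‖b n w‖ ≤ c n)
    (hc : Summable fun n => ‖a n‖ * c n) :
    ∑' n, a n * ∫ w, b n w ∂μ = ∫ w, ∑' n, a n * b n w ∂μ := by
  simp_rw [← integral_const_mul]
  refine integral_tsum_of_summable_integral_norm
    (fun n => (continuous_const.mul (hb n)).integrable_of_compactSpace) ?_
  refine Summable.of_nonneg_of_le (fun n => integral_nonneg fun _ => norm_nonneg _) (fun n => ?_)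
    (hc.mul_right (μ.real Set.univ))
  refine (Real.le_norm_self _).trans (norm_integral_le_of_norm_le_const
    (Filter.Eventually.of_forall fun w => ?_))
  rw [norm_norm, norm_mul]
  gcongr
  exact h n w

theorem fredholmBound_nonneg {M c : ℝ} (hM : 0 ≤ M) (hc : 0 ≤ c) (n : ℕ) :
    0 ≤ fredholmBound M c n := by unfold fredholmBound; positivity

/-- The p-th Taylor coefficient at z of M = D k + ϰ K_y M. The uniform bounds allow summation under
the integral. -/
theorem minorTaylor_eq (z : ℂ) (p : ℕ) (x s : X) (y : Y) :
    minorTaylor k z p x s y = detTaylor k z p y * k (x, s, y) +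
      ∫ t, k (x, t, y) * shiftTaylor (fun n => fredholmMinor k n t s y) z p := by
  have hd := isEntireSeq_fredholmCoeff k y
  have hm := isEntireSeq_fredholmMinor k x s y
  set β := fredholmBound ‖k‖ (volume.real (Set.univ : Set X))
  have hβ0 : ∀ n, 0 ≤ β n := fredholmBound_nonneg (norm_nonneg _) measureReal_nonneg
  have hint : ∑' n, (((n + 1).choose p * z ^ (n + 1 - p) : ℂ)) *
      ∫ t, k (x, t, y) * fredholmMinor k n t s y =
      ∫ t, ∑' n, (((n + 1).choose p * z ^ (n + 1 - p) : ℂ)) *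
        (k (x, t, y) * fredholmMinor k n t s y) := by
    refine integral_tsum_mul _ _ (fun n => ‖k‖ * β n) (fun n => ?_) (fun n t => ?_) ?_
    · exact (by fun_prop : Continuous fun t => k (x, t, y)).mul
        ((continuous_fredholmMinor k n).comp (by fun_prop : Continuous fun t => (t, s, y)))
    · rw [norm_mul]
      gcongr
      · exact k.norm_coe_le_norm _
      · exact norm_fredholmMinor_le k n t s y
    · refine summable_choose_succ_bound (fun n => mul_nonneg (norm_nonneg _) (hβ0 n))
        (fun r hr => ?_) z p
      simp_rw [mul_assoc]
      exact (summable_fredholmBound (norm_nonneg _) measureReal_nonneg r hr).mul_left _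
  have hrhs : ∀ t, ∑' n, (((n + 1).choose p * z ^ (n + 1 - p) : ℂ)) *
        (k (x, t, y) * fredholmMinor k n t s y) =
      k (x, t, y) * shiftTaylor (fun n => fredholmMinor k n t s y) z p := by
    intro t
    rw [← tsum_choose_succ (isEntireSeq_fredholmMinor k t s y), ← tsum_mul_left]
    exact tsum_congr fun n => by ring
  simp_rw [hrhs] at hint
  rw [← hint, minorTaylor, detTaylor, taylorCoeff, taylorCoeff,
    (hm.summable z p).tsum_eq_zero_add, (hd.summable z p).tsum_eq_zero_add, add_mul,
    ← tsum_mul_right, fredholmMinor_zero, add_assoc]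
  congr 1
  · ring
  have hs1 := (summable_nat_add_iff 1).2 (hd.summable z p)
  have hs2 := (summable_nat_add_iff 1).2 (hm.summable z p)
  simp only [fredholmMinor_succ, mul_add] at hs2
  -- By the recursion this series is the difference of two convergent ones.
  have hs3 : Summable fun n => (((n + 1).choose p * z ^ (n + 1 - p) : ℂ)) *
      ∫ t, k (x, t, y) * fredholmMinor k n t s y := by
    refine (hs2.sub (hs1.mul_right (k (x, s, y)))).congr fun n => ?_
    ring
  rw [← (hs1.mul_right _).tsum_add hs3]
  refine tsum_congr fun n => ?_
  rw [fredholmMinor_succ]; ring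

/-- D' = -∫ M(x,x) dx expanded at z, by (n+1) C(n,p) = (p+1) C(n+1,p+1). -/
theorem succ_mul_detTaylor_succ (z : ℂ) (p : ℕ) (y : Y) :
    (p + 1 : ℂ) * detTaylor k z (p + 1) y = -∫ x, minorTaylor k z p x x y := by
  have hd := isEntireSeq_fredholmCoeff k y
  set β := fredholmBound ‖k‖ (volume.real (Set.univ : Set X))
  have hint : ∑' n, ((n.choose p * z ^ (n - p) : ℂ)) * ∫ x, fredholmMinor k n x x y =
      ∫ x, minorTaylor k z p x x y := by
    refine integral_tsum_mul _ _ β (fun n => ?_) (fun n x => norm_fredholmMinor_le k n x x y) ?_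
    · exact (continuous_fredholmMinor k n).comp (by fun_prop : Continuous fun t => (t, t, y))
    · refine Summable.of_nonneg_of_le (fun n => mul_nonneg (norm_nonneg _) ?_) (fun n => ?_)
        (summable_fredholmBound (norm_nonneg k) (measureReal_nonneg (μ := (volume : Measure X))
          (s := Set.univ)) (1 + ‖z‖) (by positivity))
      · exact fredholmBound_nonneg (norm_nonneg _) measureReal_nonneg n
      · rw [mul_comm]
        gcongr
        · exact fredholmBound_nonneg (norm_nonneg _) measureReal_nonneg n
        · exact norm_choose_mul_pow_le z n p
  rw [← hint, detTaylor, taylorCoeff, (hd.summable z (p + 1)).tsum_eq_zero_add, ← tsum_neg]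
  simp only [Nat.choose_zero_succ, Nat.cast_zero, zero_mul, zero_add, ← tsum_mul_left]
  refine tsum_congr fun n => ?_
  have h := succ_mul_fredholmCoeff_succ k n y
  have h2 : ((n + 1 : ℂ)) * n.choose p = (n + 1).choose (p + 1) * (p + 1) := by
    exact_mod_cast Nat.add_one_mul_choose_eq n p
  rw [Nat.add_sub_add_right]
  linear_combination (-z ^ (n - p) * fredholmCoeff k (n + 1) y) * h2 +
    (n.choose p * z ^ (n - p)) * h

/-- If every coefficient of M vanished, so would every coefficient of D, by the trace identity and
D(z) = 0; this contradicts D(0) = 1. At the least order p of a nonzero coefficient of M, the same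
identity makes the p-th coefficient of D vanish. The order p - 1 term of M vanishes as well, so only
the homogeneous equation remains. -/
theorem exists_minorTaylor_ne_zero {z : ℂ} {y : Y} (h : detTaylor k z 0 y = 0) :
    ∃ p, (∃ x s, minorTaylor k z p x s y ≠ 0) ∧ ∀ x s, minorTaylor k z p x s y =
      z * ∫ t, k (x, t, y) * minorTaylor k z p t s y := by
  classical
  have hstep : ∀ p, (∀ x s, minorTaylor k z p x s y = 0) → detTaylor k z (p + 1) y = 0 := by
    intro p hp
    have := succ_mul_detTaylor_succ k z p y
    simp only [hp, integral_zero, neg_zero, mul_eq_zero] at this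
    exact this.resolve_left (by exact_mod_cast p.succ_ne_zero)
  have hex : ∃ p, ∃ x s, minorTaylor k z p x s y ≠ 0 := by
    by_contra! hall
    obtain ⟨p, hp⟩ := exists_taylorCoeff_ne_zero (isEntireSeq_fredholmCoeff k y)
      (by rw [fredholmCoeff_zero]; exact one_ne_zero) z
    cases p with
    | zero => exact hp h
    | succ p => exact hp (hstep p (hall p))
  refine ⟨Nat.find hex, Nat.find_spec hex, fun x s => ?_⟩
  have hmin : ∀ q < Nat.find hex, ∀ x s, minorTaylor k z q x s y = 0 := fun q hq => by
    simpa using Nat.find_min hex hq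
  generalize Nat.find hex = p at hmin
  have hdet : detTaylor k z p y = 0 := by
    cases p with
    | zero => exact h
    | succ p => exact hstep p (hmin p p.lt_succ_self)
  rw [minorTaylor_eq, hdet, zero_mul, zero_add, ← integral_const_mul]
  refine integral_congr_ae (Filter.Eventually.of_forall fun t => ?_)
  cases p with
  | zero => simp only [shiftTaylor_zero, minorTaylor]; ring
  | succ p =>
    have := hmin p p.lt_succ_self t s
    simp only [minorTaylor] at this
    simp only [shiftTaylor_succ, minorTaylor, this]; ring

/-! ### Transposition, and uniqueness where the determinant does not vanish -/

/-- The transposed kernel. -/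
def transposeKernel : C(X × X × Y, ℂ) := ⟨fun q => k (q.2.1, q.1, q.2.2), by fun_prop⟩

theorem fredholmCoeff_transposeKernel (n : ℕ) (y : Y) :
    fredholmCoeff (transposeKernel k) n y = fredholmCoeff k n y := by
  unfold fredholmCoeff
  congr 2 with x
  rw [← Matrix.det_transpose]
  rfl

theorem fredholmMinor_transposeKernel (n : ℕ) (x s : X) (y : Y) :
    fredholmMinor (transposeKernel k) n x s y = fredholmMinor k n s x y := by
  unfold fredholmMinor
  congr 2 with z
  rw [borderedDet, ← Matrix.det_transpose]
  rfl

/-- Determinants are invariant under transposition, so the relation for the transposed kernel is the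
mirror relation for `k`. -/
theorem minorTaylor_zero_eq_right (z : ℂ) (x s : X) (y : Y) :
    minorTaylor k z 0 x s y = detTaylor k z 0 y * k (x, s, y) +
      z * ∫ t, minorTaylor k z 0 x t y * k (t, s, y) := by
  have h := minorTaylor_eq (transposeKernel k) z 0 s x y
  simp only [minorTaylor, detTaylor, shiftTaylor_zero, fredholmCoeff_transposeKernel,
    fredholmMinor_transposeKernel] at h ⊢
  rw [h, ← integral_const_mul]
  congr 1
  refine integral_congr_ae (Filter.Eventually.of_forall fun t => ?_)
  simp only [transposeKernel, ContinuousMap.coe_mk]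
  ring

/-- Integrating the relation against φ(s) gives Rφ = d κφ + λ⁻¹ R(κφ). Since κφ = λφ, the last term
is Rφ, whence d κφ = 0 and φ = 0. -/
theorem ae_eq_zero_of_resolvent {κ R : X → X → ℂ} (hκ : Continuous κ.uncurry)
    (hR : Continuous R.uncurry) {lam d : ℂ} (hlam : lam ≠ 0) (hd : d ≠ 0)
    (hres : ∀ x s, R x s = d * κ x s + lam⁻¹ * ∫ t, R x t * κ t s)
    {φ : X → ℂ} (hφ : Integrable φ) (heq : ∀ᵐ x, lam * φ x = ∫ s, κ x s * φ s) :
    φ =ᵐ[volume] 0 := by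
  have hbdd : ∀ f : X → ℂ, Continuous f → Integrable fun s => f s * φ s := fun f hf => by
    obtain ⟨C, hC⟩ := isCompact_univ.exists_bound_of_continuousOn hf.continuousOn
    exact hφ.bdd_mul hf.aestronglyMeasurable (Filter.Eventually.of_forall fun s => hC s trivial)
  have hzero : ∀ x, ∫ s, κ x s * φ s = 0 := by
    intro x
    have hc : Continuous fun q : X × X => R x q.2 * κ q.2 q.1 :=
      (hR.comp (by fun_prop : Continuous fun q : X × X => (x, q.2))).mul
        (hκ.comp (by fun_prop : Continuous fun q : X × X => (q.2, q.1)))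
    have h1 : ∫ s, R x s * φ s = d * (∫ s, κ x s * φ s) +
        lam⁻¹ * ∫ s, ∫ t, R x t * (κ t s * φ s) := by
      rw [← integral_const_mul, ← integral_const_mul, ← integral_add]
      · refine integral_congr_ae (Filter.Eventually.of_forall fun s => ?_)
        simp only
        rw [hres]
        simp_rw [← mul_assoc]
        rw [integral_mul_const]; ring
      · exact (hbdd _ (hκ.comp (by fun_prop : Continuous fun s => (x, s)))).const_mul _
      · refine Integrable.const_mul ?_ _
        simp_rw [← mul_assoc, integral_mul_const]
        exact hbdd _ (continuous_integral_of_compactSpace hc)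
    have hI : Integrable (fun q : X × X => R x q.2 * (κ q.2 q.1 * φ q.1))
        ((volume : Measure X).prod volume) := by
      obtain ⟨C, hC⟩ := isCompact_univ.exists_bound_of_continuousOn hc.continuousOn
      simp_rw [← mul_assoc]
      exact (hφ.comp_fst _).bdd_mul hc.aestronglyMeasurable
        (Filter.Eventually.of_forall fun s => hC s trivial)
    rw [integral_integral_swap hI] at h1
    have h2 : ∫ t, ∫ s, R x t * (κ t s * φ s) = lam * ∫ t, R x t * φ t := by
      rw [← integral_const_mul]
      refine integral_congr_ae ?_
      filter_upwards [heq] with t ht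
      rw [integral_const_mul, ← ht]; ring
    rw [h2, inv_mul_cancel_left₀ hlam] at h1
    have h3 : d * (∫ s, κ x s * φ s) = 0 := by linear_combination -h1
    exact (mul_eq_zero.1 h3).resolve_left hd
  filter_upwards [heq] with x hx
  rw [hzero] at hx
  exact (mul_eq_zero.1 hx).resolve_left hlam

theorem ae_eq_zero_of_detTaylor_ne_zero {lam : ℂ} (hlam : lam ≠ 0) {y : Y}
    (h : detTaylor k lam⁻¹ 0 y ≠ 0) {φ : X → ℂ} (hφ : Integrable φ)
    (heq : ∀ᵐ x, lam * φ x = ∫ s, k (x, s, y) * φ s) : φ =ᵐ[volume] 0 :=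
  ae_eq_zero_of_resolvent (κ := fun x s => k (x, s, y)) (R := fun x s => minorTaylor k lam⁻¹ 0 x s y)
    (by fun_prop) (continuous_minorTaylor_comp k continuous_fst continuous_snd continuous_const)
    hlam h (fun x s => minorTaylor_zero_eq_right k lam⁻¹ x s y) hφ heq

end Fredholm

/-! ### From the fibres back to the partial integral operator -/

namespace PartialOp

variable {ν : ℕ} {a b : ℝ}

theorem D₁_eq_detTaylor (k : Kern ν a b) (y : Cube ν a b) (z : ℂ) :
    D₁ k y z = detTaylor k z 0 y := by
  unfold D₁ detTaylor taylorCoeff fredholmCoeff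
  refine tsum_congr fun n => ?_
  rw [neg_pow, Nat.choose_zero_right, Nat.sub_zero]
  push_cast
  ring

theorem continuous_D₁ (k : Kern ν a b) (z : ℂ) : Continuous fun y => D₁ k y z := by
  simp_rw [D₁_eq_detTaylor]
  exact continuous_detTaylor k z 0

theorem ae_swap {P : Cube ν a b × Cube ν a b → Prop} (h : ∀ᵐ p, P p) :
    ∀ᵐ y : Cube ν a b, ∀ᵐ x : Cube ν a b, P (x, y) :=
  Measure.ae_ae_of_ae_prod ((Measure.measurePreserving_swap (μ := (volume : Measure (Cube ν a b)))
      (ν := (volume : Measure (Cube ν a b)))).quasiMeasurePreserving.ae h)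

theorem eq_zero_of_ae_section {f : SqInt ν a b}
    (h : ∀ᵐ y : Cube ν a b, ∀ᵐ x : Cube ν a b, f (x, y) = 0) : f = 0 := by
  have hm : MeasurableSet {q : Cube ν a b × Cube ν a b | f (q.2, q.1) = 0} :=
    ((Lp.stronglyMeasurable f).measurable.comp measurable_swap) (measurableSet_singleton 0)
  have h1 : ∀ᵐ q ∂((volume : Measure (Cube ν a b)).prod volume), f (q.2, q.1) = 0 :=
    (Measure.ae_prod_iff_ae_ae hm).2 h
  have h2 := (Measure.measurePreserving_swap (μ := (volume : Measure (Cube ν a b)))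
      (ν := (volume : Measure (Cube ν a b)))).quasiMeasurePreserving.ae h1
  exact (Lp.eq_zero_iff_ae_eq_zero).2 h2

theorem inv_mem_characteristicNumbers {k : Kern ν a b} {lam : ℂ} (hlam : lam ≠ 0)
    {f : SqInt ν a b} (hf : f ≠ 0) (hT : T₁ k f = lam • f) :
    lam⁻¹ ∈ characteristicNumbers k := by
  have hmeas : MeasurableSet {y | D₁ k y lam⁻¹ = 0} :=
    (isClosed_singleton.preimage (continuous_D₁ k lam⁻¹)).measurableSet
  -- The witness is the whole zero set, closed by continuity of `D₁`. Were it null, almost every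
  -- section of `f` would vanish.
  refine ⟨{y | D₁ k y lam⁻¹ = 0}, hmeas, ?_, fun y hy => hy⟩
  rw [pos_iff_ne_zero]
  intro h0
  have hne : ∀ᵐ y : Cube ν a b, D₁ k y lam⁻¹ ≠ 0 := by
    rw [ae_iff]; simpa using h0
  have heq : ∀ᵐ p : Cube ν a b × Cube ν a b,
      lam * f p = ∫ s : Cube ν a b, k (p.1, s, p.2) * f (s, p.2) := by
    have h1 := T₁_ae_eq k f
    rw [hT] at h1
    filter_upwards [h1, Lp.coeFn_smul lam f] with p hp hs
    rw [← hp, hs]; rfl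
  have hi : Integrable f ((volume : Measure (Cube ν a b)).prod volume) :=
    (Lp.memLp f).integrable (by norm_num)
  have hint : ∀ᵐ y : Cube ν a b, Integrable (fun s : Cube ν a b => f (s, y)) :=
    hi.swap.prod_right_ae
  refine hf (eq_zero_of_ae_section ?_)
  filter_upwards [hne, ae_swap heq, hint] with y hy h1 h2
  exact ae_eq_zero_of_detTaylor_ne_zero k hlam (by rwa [← D₁_eq_detTaylor]) h2 h1

/-- The parameters `y` for which `g (·, y)` is a nonzero solution of `g = z K_y g`. -/
def solutionSet (k : Kern ν a b) (z : ℂ) (g : Cube ν a b × Cube ν a b → ℂ) : Set (Cube ν a b) :=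
  {y | (∃ x, g (x, y) ≠ 0) ∧ ∀ x, g (x, y) = z * partialIntegral k g (x, y)}

/-- Uncountably many x are quantified over, but by continuity the first condition is open in y and
the second is closed. -/
theorem measurableSet_solutionSet (k : Kern ν a b) (z : ℂ) {g : Cube ν a b × Cube ν a b → ℂ}
    (hg : Continuous g) : MeasurableSet (solutionSet k z g) := by
  have h1 : {y | ∃ x, g (x, y) ≠ 0} = ⋃ x, {y | g (x, y) ≠ 0} := by ext; simp
  have h2 : {y | ∀ x, g (x, y) = z * partialIntegral k g (x, y)} =
      ⋂ x, {y | g (x, y) = z * partialIntegral k g (x, y)} := by ext; simp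
  refine MeasurableSet.inter ?_ ?_
  · change MeasurableSet {y | ∃ x, g (x, y) ≠ 0}
    rw [h1]
    exact (isOpen_iUnion fun x => isOpen_ne_fun (by fun_prop) (by fun_prop)).measurableSet
  · change MeasurableSet {y | ∀ x, g (x, y) = z * partialIntegral k g (x, y)}
    rw [h2]
    refine (isClosed_iInter fun x => isClosed_eq (by fun_prop)
      (continuous_const.mul ?_)).measurableSet
    exact continuous_integral_of_compactSpace
      (f := fun y s => k (x, s, y) * g (s, y)) (by fun_prop)

/-- The operator never mixes different y, so restricting g to the fibres over the solution set
preserves the equation. -/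
theorem hasEigenvalue_of_solutionSet {k : Kern ν a b} {lam : ℂ} (hlam : lam ≠ 0)
    {g : Cube ν a b × Cube ν a b → ℂ} (hg : Continuous g)
    (hpos : volume (solutionSet k lam⁻¹ g) ≠ 0) :
    Module.End.HasEigenvalue (T₁ k : SqInt ν a b →ₗ[ℂ] SqInt ν a b) lam := by
  set A := solutionSet k lam⁻¹ g with hA
  have hAm : MeasurableSet A := measurableSet_solutionSet k _ hg
  set F : Cube ν a b × Cube ν a b → ℂ := (Prod.snd ⁻¹' A).indicator g with hF
  have hFx : ∀ x, ∀ y ∈ A, F (x, y) = g (x, y) := fun x y hy =>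
    Set.indicator_of_mem (s := Prod.snd ⁻¹' A) (a := (x, y)) hy g
  have hFx' : ∀ x, ∀ y ∉ A, F (x, y) = 0 := fun x y hy =>
    Set.indicator_of_notMem (s := Prod.snd ⁻¹' A) (a := (x, y)) hy g
  have hmem : MemLp F 2 := by
    obtain ⟨C, hC⟩ := isCompact_univ.exists_bound_of_continuousOn hg.continuousOn
    exact (MemLp.of_bound hg.aestronglyMeasurable C
      (Filter.Eventually.of_forall fun p => hC p trivial)).indicator (measurable_snd hAm)
  have hpI : ∀ p, partialIntegral k F p = lam * F p := by
    rintro ⟨x, y⟩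
    by_cases hy : y ∈ A
    · have h1 : partialIntegral k F (x, y) = partialIntegral k g (x, y) := by
        simp only [partialIntegral, hFx _ y hy]
      rw [h1, hFx _ y hy, hy.2 x, mul_inv_cancel_left₀ hlam]
    · simp [partialIntegral, hFx' _ y hy]
  refine Module.End.hasEigenvalue_of_hasEigenvector (x := hmem.toLp F) ⟨?_, ?_⟩
  · rw [Module.End.mem_eigenspace_iff, ← MemLp.toLp_const_smul]
    change (memLp_partialIntegral k (Lp.memLp (hmem.toLp F))).toLp _ = _
    rw [MemLp.toLp_eq_toLp_iff]
    exact (partialIntegral_congr k hmem.coeFn_toLp).trans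
      (Filter.Eventually.of_forall hpI)
  · intro h0
    have hae : ∀ᵐ p, F p = 0 := by
      have h1 := hmem.coeFn_toLp
      have h2 := (Lp.eq_zero_iff_ae_eq_zero).1 h0
      filter_upwards [h1, h2] with p hp hq
      rw [← hp, hq]; rfl
    refine hpos ((measure_eq_zero_iff_ae_notMem).2 ?_)
    filter_upwards [ae_swap hae] with y hy hyA
    obtain ⟨x, hx⟩ := hyA.1
    refine hx ?_
    -- The integral equation recovers g at every point x from its almost everywhere values, so a
    -- section vanishing almost everywhere vanishes identically.
    rw [hyA.2 x, partialIntegral, integral_eq_zero_of_ae, mul_zero]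
    filter_upwards [hy] with s hs
    rw [hFx s y hyA] at hs
    simp [hs]

theorem hasEigenvalue_of_inv_mem {k : Kern ν a b} {lam : ℂ} (hlam : lam ≠ 0)
    (h : lam⁻¹ ∈ characteristicNumbers k) :
    Module.End.HasEigenvalue (T₁ k : SqInt ν a b →ₗ[ℂ] SqInt ν a b) lam := by
  obtain ⟨Ω₀, -, hpos, hD⟩ := h
  obtain ⟨S, hSc, hSd⟩ := TopologicalSpace.exists_countable_dense (Cube ν a b)
  have := hSc.to_subtype
  let G : ℕ → Cube ν a b → Cube ν a b × Cube ν a b → ℂ :=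
    fun p s q => minorTaylor k lam⁻¹ p q.1 s q.2
  have hG : ∀ p s, Continuous (G p s) := fun p s => 
    continuous_minorTaylor_comp k continuous_fst continuous_const continuous_snd
  have hsub : Ω₀ ⊆ ⋃ i : ℕ × S, solutionSet k lam⁻¹ (G i.1 i.2) := by
    intro y hy
    obtain ⟨p, ⟨x, s, hne⟩, hsol⟩ :=
      exists_minorTaylor_ne_zero k ((D₁_eq_detTaylor k y lam⁻¹).symm.trans (hD y hy))
    -- Being nonzero is an open condition on s, and the equation holds for every s, so s can be
    -- moved into the countable dense set.
    have hopen : IsOpen {s | minorTaylor k lam⁻¹ p x s y ≠ 0} :=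
      isOpen_ne_fun (continuous_minorTaylor_comp k continuous_const continuous_id continuous_const) continuous_const
    obtain ⟨s', hs', hs'S⟩ := hSd.inter_open_nonempty _ hopen ⟨s, hne⟩
    exact Set.mem_iUnion.2 ⟨(p, ⟨s', hs'S⟩), ⟨x, hs'⟩, fun x => hsol x s'⟩
  obtain ⟨i, hi⟩ : ∃ i : ℕ × S, volume (solutionSet k lam⁻¹ (G i.1 i.2)) ≠ 0 := by
    by_contra! hall
    exact hpos.ne' (measure_mono_null hsub (measure_iUnion_null hall))
  exact hasEigenvalue_of_solutionSet hlam (hG _ _) hi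

end PartialOp

end

theorem theorem1 (ν : ℕ) (a b : ℝ) (hab : a < b) (k : Kern ν a b) (lam : ℂ) (hlam : lam ≠ 0) :
    Module.End.HasEigenvalue (PartialOp.T₁ k : SqInt ν a b →ₗ[ℂ] SqInt ν a b) lam ↔
      lam⁻¹ ∈ PartialOp.characteristicNumbers k := by
  refine ⟨fun h => ?_, PartialOp.hasEigenvalue_of_inv_mem hlam⟩
  obtain ⟨f, hf⟩ := h.exists_hasEigenvector
  exact PartialOp.inv_mem_characteristicNumbers hlam hf.2 hf.apply_eq_smul
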